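/- Let $\mathcal X,\mathcal Y,\mathcal S$ be finite alphabets. At each channel use a state $S_i\in\mathcal S$ is drawn i.i.d. from a PMF $P_S$, unknown to both transmitter and receiver, and the output $Y_i$ is drawn from $P(\cdot\mid x_i,s_i)$, independently across channel uses. Let $d:\mathcal S\times\mathcal S\to[0,\infty)$ be a distortion function and $v:\mathcal X\to[0,\infty)$ an input cost function. An $(M,n)$-code consists of an encoder $f_n:\{1,\dots,M\}\to\mathcal X^n$, with codewords $x^n(m)=f_n(m)$, a decoder $g_n:\mathcal Y^n\to\{1,\dots,M\}$ and a state estimator $h_n:\mathcal Y^n\to\mathcal S^n$, $\hat S^n=h_n(Y^n)$. Put $$P_e^{(n)}=\frac1M\sum_{m}\Pr[g_n(Y^n)\ne m\mid X^n=f_n(m)],$$ $$\bar d^{(n)}=\frac1M\sum_m \mathbf E\Big[\frac1n\sum_{i=1}^n d(S_i,\hat S_i)\,\Big|\,X^n=f_n(m)\Big],\qquad \bar v^{(n)}=\frac1{nM}\sum_m\sum_{i=1}^n v(x_i(m)).$$ For real $D,V$, a rate $R\ge 0$ is called $(D,V)$-achievable if there is a sequence of $(\lceil e^{nR}\rceil,n)$-codes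 with $\lim_{n\to\infty} P_e^{(n)}=0$, $\limsup_{n\to\infty}\bar d^{(n)}\le D$ and $\limsup_{n\to\infty}\bar v^{(n)}\le V$. The capacity-distortion-cost function $C(D,V)$ is the supremum of the $(D,V)$-achievable rates. Let $$d^*(x)=\min_{h:\mathcal X\times\mathcal Y\to\mathcal S}\ \sum_{s\in\mathcal S}\sum_{y\in\mathcal Y}P_S(s)P(y\mid x,s)\,d(s,h(x,y)),$$ $$\mathcal P_D=\Big\{P_X:\sum_x P_X(x)d^*(x)\le D\Big\},\qquad \mathcal P_V=\Big\{P_X:\sum_x P_X(x)v(x)\le V\Big\},$$ where $P_X$ ranges over the probability mass functions on $\mathcal X$. Theorem. A $(D,V)$-achievable rate exists if and only if $\mathcal P_D\cap\mathcal P_V\neq\emptyset$. In that case the set of achievable rates is bounded above, and $$C(D,V)=\max_{P_X\in\mathcal P_D\cap\mathcal P_V} I(X;Y),$$ with the maximum attained, where $I(X;Y)$ is the mutual information in nats for the input law $P_X$ and the channel $\Pr[Y=y\mid X=x]=\sum_s P_S(s)P(y\mid x,s)$. -/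

import Mathlib

open Filter Topology

noncomputable section

namespace JointCommEst

/-- A memoryless state-dependent channel with input alphabet `X`, output alphabet `Y` and state
alphabet `S`: the state law `PS`, the transition probabilities `W x s y = P(y | x, s)`,
the distortion measure `d` on states and the input cost `v`. -/
structure Model (X Y S : Type*) [Fintype Y] [Fintype S] where
  PS : S → ℝ
  PS_mem : PS ∈ stdSimplex ℝ S
  W : X → S → Y → ℝ
  W_mem : ∀ x s, W x s ∈ stdSimplex ℝ Y
  d : S → S → ℝ
  d_nonneg : ∀ s s', 0 ≤ d s s'
  v : X → ℝ
  v_nonneg : ∀ x, 0 ≤ v x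

/-- An `(M, n)`-code: encoder, decoder and state estimator. -/
structure Code (X Y S : Type*) (M n : ℕ) where
  enc : Fin M → (Fin n → X)
  dec : (Fin n → Y) → Fin M
  est : (Fin n → Y) → (Fin n → S)

/-- The mutual information, in nats, of a pair with joint probability mass function `Q`.
Terms with `Q a b = 0` vanish, as in the convention `0 log 0 = 0`. -/
def mutualInfo {A B : Type*} [Fintype A] [Fintype B] (Q : A → B → ℝ) : ℝ :=
  ∑ a, ∑ b, Q a b * Real.log (Q a b / ((∑ b', Q a b') * (∑ a', Q a' b)))

namespace Model

variable {X Y S : Type*} [Fintype X] [Fintype Y] [Fintype S]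

/-- `Pr[S^n = s, Y^n = y | X^n = x]`: memoryless states, independent channel uses. -/
def blockProb (K : Model X Y S) {n : ℕ} (x : Fin n → X) (s : Fin n → S) (y : Fin n → Y) : ℝ :=
  (∏ i, K.PS (s i)) * ∏ i, K.W (x i) (s i) (y i)

/-- Average probability of decoding error. -/
def errorProb (K : Model X Y S) {M n : ℕ} (c : Code X Y S M n) : ℝ :=
  (1 / (M : ℝ)) * ∑ m, ∑ s : Fin n → S, ∑ y : Fin n → Y,
    if c.dec y ≠ m then K.blockProb (c.enc m) s y else 0

/-- Average state estimation distortion. -/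
def avgDistortion (K : Model X Y S) {M n : ℕ} (c : Code X Y S M n) : ℝ :=
  (1 / (M : ℝ)) * ∑ m, ∑ s : Fin n → S, ∑ y : Fin n → Y,
    K.blockProb (c.enc m) s y * ((1 / (n : ℝ)) * ∑ i, K.d (s i) (c.est y i))

/-- Average input cost. -/
def avgCost (K : Model X Y S) {M n : ℕ} (c : Code X Y S M n) : ℝ :=
  (1 / ((n : ℝ) * (M : ℝ))) * ∑ m, ∑ i, K.v (c.enc m i)

/-- `(R, D, V)` is achievable by a sequence of `(⌈e^{nR}⌉, n)`-codes. The `limsup`s are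
of bounded real sequences; the index `n = 0` does not affect any of the limits. -/
def Achievable (K : Model X Y S) (R D V : ℝ) : Prop :=
  ∃ c : ∀ n : ℕ, Code X Y S ⌈Real.exp ((n : ℝ) * R)⌉₊ n,
    Tendsto (fun n => K.errorProb (c n)) atTop (𝓝 0) ∧
    limsup (fun n => K.avgDistortion (c n)) atTop ≤ D ∧
    limsup (fun n => K.avgCost (c n)) atTop ≤ V

/-- The nonnegative rates `R` for which `(R, D, V)` is achievable. -/
def achievableRates (K : Model X Y S) (D V : ℝ) : Set ℝ :=
  {R | 0 ≤ R ∧ K.Achievable R D V}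

/-- The capacity-distortion-cost function `C(D, V)`, meaningful when the set of achievable rates
is nonempty and bounded above. -/
def capacity (K : Model X Y S) (D V : ℝ) : ℝ :=
  sSup (K.achievableRates D V)

/-- The estimation cost `d*(x)`: minimum of `E[d(S, h(X, Y)) | X = x]` over the (finitely many)
one-shot estimators `h`. -/
def estCost (K : Model X Y S) (x : X) : ℝ :=
  ⨅ h : X × Y → S, ∑ s, ∑ y, K.PS s * K.W x s y * K.d s (h (x, y))

/-- The channel with the state averaged out, `Pr[Y = y | X = x]`. -/
def marginal (K : Model X Y S) (x : X) (y : Y) : ℝ :=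
  ∑ s, K.PS s * K.W x s y

/-- `I(X; Y)` for the input law `P`. -/
def inputInfo (K : Model X Y S) (P : X → ℝ) : ℝ :=
  mutualInfo fun x y => P x * K.marginal x y

/-- Input distributions satisfying the estimation cost constraint. -/
def estSet (K : Model X Y S) (D : ℝ) : Set (X → ℝ) :=
  {P | P ∈ stdSimplex ℝ X ∧ ∑ x, P x * K.estCost x ≤ D}

/-- Input distributions satisfying the input cost constraint. -/
def costSet (K : Model X Y S) (V : ℝ) : Set (X → ℝ) :=
  {P | P ∈ stdSimplex ℝ X ∧ ∑ x, P x * K.v x ≤ V}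

end Model

end JointCommEst

end

open Filter Topology

noncomputable section

namespace JointCommEst

/-! ### Expectations under product laws. -/

section ProductWeights

variable {ι A : Type*} [Fintype ι] [DecidableEq ι] [Fintype A]

/-! Converse: attach to a code its empirical input law `Q`. With the other outputs frozen, a block
estimator acts at one position as a one-shot estimator, so `Q` pays at most the code's distortion
(`sum_empiricalLaw_mul_estCost_le`); its cost is exactly the code's cost. A variational form of
Fano's inequality (`one_sub_errorProb_mul_log_le`) bounds the rate by `inputInfo Q` up to vanishing
terms. A limit point of these laws in the compact simplex meets both constraints, and continuity of
mutual information carries the rate bound to it.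

Achievability: draw codewords i.i.d. from a feasible `P` and decode by a likelihood threshold
(`exists_code_le`). The averaged quantity is the error plus the squared deviations of estimation
cost and input cost from their means; all three are nonnegative, so one code makes each of them
small. The receiver estimates the state from the decoded codeword and the output, losing only a
bounded amount on decoding errors (`avgDistortion_le_of_est_eq`). Rate zero needs only one message
and is treated with the same lemma, `achievable_of_tendsto`. -/

theorem sum_pi_prod (F : ι → A → ℝ) :
    ∑ c : ι → A, ∏ k, F k (c k) = ∏ k, ∑ a, F k a := by
  classical
  rw [Finset.prod_univ_sum, Fintype.piFinset_univ]

theorem prod_mem_stdSimplex (p : ι → A → ℝ) (hp : ∀ k, p k ∈ stdSimplex ℝ A) :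
    (fun c : ι → A => ∏ k, p k (c k)) ∈ stdSimplex ℝ (ι → A) := by
  refine ⟨fun c => Finset.prod_nonneg fun k _ => (hp k).1 _, ?_⟩
  rw [sum_pi_prod]
  exact Finset.prod_eq_one fun k _ => (hp k).2

/-- Resampling the coordinate `i` does not change an expectation under a product law. -/
theorem sum_pi_prod_mul_resample (p : ι → A → ℝ) (hp : ∀ k, ∑ a, p k a = 1) (i : ι)
    (f : (ι → A) → ℝ) :
    ∑ c : ι → A, (∏ k, p k (c k)) * f c =
      ∑ c : ι → A, (∏ k, p k (c k)) * ∑ a, p i a * f (Function.update c i a) := by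
  -- Splitting off coordinate `i` leaves an inner average over that coordinate alone; resampling it
  -- again is then averaging a constant.
  have key : ∀ g : (ι → A) → ℝ, ∑ c : ι → A, (∏ k, p k (c k)) * g c =
      ∑ w : {j // j ≠ i} → A, (∏ k : {j // j ≠ i}, p k (w k)) *
        ∑ a, p i a * g ((Equiv.funSplitAt i A).symm (a, w)) := by
    intro g
    rw [← (Equiv.funSplitAt i A).symm.sum_comp, Fintype.sum_prod_type, Finset.sum_comm]
    refine Finset.sum_congr rfl fun w _ => ?_
    rw [Finset.mul_sum]
    refine Finset.sum_congr rfl fun a _ => ?_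
    rw [Fintype.prod_eq_mul_prod_subtype_ne _ i]
    have h1 : (Equiv.funSplitAt i A).symm (a, w) i = a := by simp
    have h2 : ∀ k : {j // j ≠ i}, (Equiv.funSplitAt i A).symm (a, w) k = w k := by
      intro k
      simp [k.2]
    simp only [h1, h2]
    ring
  rw [key, key]
  refine Finset.sum_congr rfl fun w _ => ?_
  congr 1
  have h3 : ∀ a b, Function.update ((Equiv.funSplitAt i A).symm (a, w)) i b =
      (Equiv.funSplitAt i A).symm (b, w) := by
    intro a b
    ext j
    by_cases hj : j = i
    · subst hj; simp
    · simp [hj]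
  simp only [h3]
  rw [← Finset.sum_mul, hp, one_mul]

theorem le_sum_pi_prod_mul (p : ι → A → ℝ) (hp : ∀ k, p k ∈ stdSimplex ℝ A) (i : ι)
    (f : (ι → A) → ℝ) (t : ℝ) (h : ∀ c, t ≤ ∑ a, p i a * f (Function.update c i a)) :
    t ≤ ∑ c : ι → A, (∏ k, p k (c k)) * f c := by
  rw [sum_pi_prod_mul_resample p (fun k => (hp k).2) i]
  have hs := prod_mem_stdSimplex p hp
  calc t = ∑ c : ι → A, (∏ k, p k (c k)) * t := by rw [← Finset.sum_mul, hs.2, one_mul]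
    _ ≤ _ := Finset.sum_le_sum fun c _ => mul_le_mul_of_nonneg_left (h c) (hs.1 c)

theorem sum_pi_prod_mul_apply (p : ι → A → ℝ) (hp : ∀ k, ∑ a, p k a = 1) (i : ι) (f : A → ℝ) :
    ∑ c : ι → A, (∏ k, p k (c k)) * f (c i) = ∑ a, p i a * f a := by
  rw [sum_pi_prod_mul_resample p hp i]
  simp only [Function.update_self]
  rw [← Finset.sum_mul, sum_pi_prod]
  simp [hp]

theorem sum_pi_prod_mul_apply_mul_apply (p : ι → A → ℝ) (hp : ∀ k, ∑ a, p k a = 1) {i j : ι}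
    (hij : i ≠ j) (f g : A → ℝ) :
    ∑ c : ι → A, (∏ k, p k (c k)) * (f (c i) * g (c j)) =
      (∑ a, p i a * f a) * ∑ a, p j a * g a := by
  rw [sum_pi_prod_mul_resample p hp i]
  simp only [Function.update_self, Function.update_of_ne hij.symm]
  simp only [← mul_assoc (p i _), ← Finset.sum_mul]
  rw [← sum_pi_prod_mul_apply p hp j g, Finset.mul_sum]
  exact Finset.sum_congr rfl fun c _ => by ring

/-- Independence and centering kill the off-diagonal terms of the expanded square. -/
theorem sum_pi_prod_mul_sq_sum (p : A → ℝ) (hp : ∑ a, p a = 1) (f : A → ℝ)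
    (hf : ∑ a, p a * f a = 0) :
    ∑ c : ι → A, (∏ k, p (c k)) * (∑ i, f (c i)) ^ 2 =
      Fintype.card ι * ∑ a, p a * f a ^ 2 := by
  calc ∑ c : ι → A, (∏ k, p (c k)) * (∑ i, f (c i)) ^ 2
      = ∑ i, ∑ j, ∑ c : ι → A, (∏ k, p (c k)) * (f (c i) * f (c j)) := by
        simp only [sq, Finset.sum_mul_sum]
        simp only [Finset.mul_sum]
        rw [Finset.sum_comm]
        exact Finset.sum_congr rfl fun i _ => Finset.sum_comm
    _ = ∑ i : ι, ∑ j : ι, if i = j then ∑ a, p a * f a ^ 2 else 0 := by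
        refine Finset.sum_congr rfl fun i _ => Finset.sum_congr rfl fun j _ => ?_
        split_ifs with h
        · subst h
          simpa only [sq] using
            sum_pi_prod_mul_apply (fun _ => p) (fun _ => hp) i (fun a => f a * f a)
        · rw [sum_pi_prod_mul_apply_mul_apply (fun _ => p) (fun _ => hp) h, hf, zero_mul]
    _ = _ := by simp

/-- The mean square deviation of an empirical average under an i.i.d. law. -/
theorem sum_pi_prod_mul_sq_average_sub (p : A → ℝ) (hp : ∑ a, p a = 1) (f : A → ℝ) {n : ℕ}
    (hn : n ≠ 0) :
    ∑ c : Fin n → A, (∏ k, p (c k)) * ((1 / (n : ℝ)) * ∑ i, f (c i) - ∑ a, p a * f a) ^ 2 =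
      (∑ a, p a * (f a - ∑ a, p a * f a) ^ 2) / n := by
  have hn' : (n : ℝ) ≠ 0 := by exact_mod_cast hn
  have h := sum_pi_prod_mul_sq_sum (ι := Fin n) p hp (fun a => f a - ∑ a, p a * f a) (by
    simp only [mul_sub, Finset.sum_sub_distrib, ← Finset.sum_mul, hp, one_mul, sub_self])
  have h2 : ∀ c : Fin n → A, (1 / (n : ℝ)) * ∑ i, f (c i) - ∑ a, p a * f a =
      (1 / (n : ℝ)) * ∑ i, (f (c i) - ∑ a, p a * f a) := by
    intro c
    rw [Finset.sum_sub_distrib, Finset.sum_const, Finset.card_univ, Fintype.card_fin, nsmul_eq_mul]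
    field_simp
  simp only [h2, mul_pow]
  simp only [mul_left_comm _ ((1 / (n : ℝ)) ^ 2), ← Finset.mul_sum]
  rw [h, Fintype.card_fin]
  field_simp

end ProductWeights

/-! ### Random coding. -/

theorem exists_le_of_sum_mul_le {A : Type*} [Fintype A] (w : A → ℝ) (hw : w ∈ stdSimplex ℝ A)
    (F : A → ℝ) (t : ℝ) (h : ∑ a, w a * F a ≤ t) : ∃ a, F a ≤ t := by
  by_contra! hF
  have h1 : ∑ a, w a * (F a - t) ≤ 0 := by
    simp only [mul_sub, Finset.sum_sub_distrib, ← Finset.sum_mul, hw.2, one_mul]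
    linarith
  have h2 : ∀ a ∈ Finset.univ, 0 ≤ w a * (F a - t) := fun a _ =>
    mul_nonneg (hw.1 a) (sub_nonneg.2 (hF a).le)
  have h3 := (Finset.sum_eq_zero_iff_of_nonneg h2).1 (le_antisymm h1 (Finset.sum_nonneg h2))
  have h4 : ∀ a, w a = 0 := fun a => by
    rcases mul_eq_zero.1 (h3 a (Finset.mem_univ a)) with h | h
    · exact h
    · linarith [hF a]
  have := hw.2
  simp [h4] at this

/-- Random coding with a threshold decoder; `φ` is an additive penalty on codewords. -/
theorem exists_code_le {A B : Type*} [Fintype A] [Fintype B] (P : A → ℝ)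
    (hP : P ∈ stdSimplex ℝ A) (W : A → B → ℝ) (hW : ∀ a, W a ∈ stdSimplex ℝ B) (q : B → ℝ)
    (hq : ∀ b, q b = ∑ a, P a * W a b) {θ : ℝ} (hθ : 0 < θ) {M : ℕ} (hM : 0 < M) (φ : A → ℝ) :
    ∃ (enc : Fin M → A) (dec : B → Fin M),
      (1 / (M : ℝ)) * ∑ m, ((∑ b, if dec b ≠ m then W (enc m) b else 0) + φ (enc m)) ≤
        (∑ a, P a * ((∑ b, if W a b ≤ θ * q b then W a b else 0) + φ a)) + (M - 1) / θ := by
  classical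
  -- Any message above the threshold will do; message 0 is the default when there is none.
  have hdec : ∀ enc : Fin M → A, ∃ dec : B → Fin M, ∀ b,
      (∃ m, θ * q b < W (enc m) b) → θ * q b < W (enc (dec b)) b := by
    intro enc
    refine ⟨fun b => if h : ∃ m, θ * q b < W (enc m) b then h.choose else ⟨0, hM⟩, ?_⟩
    intro b h
    simpa [h] using h.choose_spec
  choose dec hdec using hdec
  have hMr : (0 : ℝ) < M := by exact_mod_cast hM
  -- Union bound: an error needs the true codeword below the threshold or a wrong one above it.
  have hpt : ∀ (c : Fin M → A) (m : Fin M) (b : B),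
      (if dec c b ≠ m then W (c m) b else 0) ≤
        (if W (c m) b ≤ θ * q b then W (c m) b else 0) +
          ∑ m' ∈ Finset.univ.erase m, W (c m) b * (if θ * q b < W (c m') b then 1 else 0) := by
    intro c m b
    have hnn : ∀ m' ∈ Finset.univ.erase m,
        0 ≤ W (c m) b * (if θ * q b < W (c m') b then (1 : ℝ) else 0) := fun m' _ =>
      mul_nonneg ((hW _).1 b) (by split_ifs <;> norm_num)
    have hs := Finset.sum_nonneg hnn
    have hwb := (hW (c m)).1 b
    by_cases h1 : dec c b ≠ m
    · rw [if_pos h1]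
      by_cases h2 : W (c m) b ≤ θ * q b
      · rw [if_pos h2]; linarith
      · rw [if_neg h2, zero_add]
        have h3 := hdec c b ⟨m, not_le.1 h2⟩
        have h4 := Finset.single_le_sum hnn (Finset.mem_erase.2 ⟨h1, Finset.mem_univ (dec c b)⟩)
        simpa only [if_pos h3, mul_one] using h4
    · rw [if_neg h1]
      split_ifs <;> linarith
  -- Averaging over the independent true codeword turns its likelihood into `q`, and above the
  -- threshold `q b ≤ W a b / θ`.
  have hpair : ∀ m m' : Fin M, m ≠ m' →
      ∑ c : Fin M → A, (∏ k, P (c k)) *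
        ∑ b, W (c m) b * (if θ * q b < W (c m') b then (1 : ℝ) else 0) ≤ 1 / θ := by
    intro m m' hmm
    calc _ = ∑ b, ∑ c : Fin M → A, (∏ k, P (c k)) *
          (W (c m) b * (if θ * q b < W (c m') b then (1 : ℝ) else 0)) := by
          simp only [Finset.mul_sum]
          exact Finset.sum_comm
      _ = ∑ b, q b * ∑ a, P a * (if θ * q b < W a b then (1 : ℝ) else 0) := by
          refine Finset.sum_congr rfl fun b _ => ?_
          rw [sum_pi_prod_mul_apply_mul_apply (fun _ => P) (fun _ => hP.2) hmm
            (fun a => W a b) (fun a => if θ * q b < W a b then (1 : ℝ) else 0), hq]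
      _ ≤ ∑ b, ∑ a, P a * W a b / θ := by
          refine Finset.sum_le_sum fun b _ => ?_
          rw [Finset.mul_sum]
          refine Finset.sum_le_sum fun a _ => ?_
          rw [le_div_iff₀ hθ]
          have h1 := hP.1 a
          have h2 := (hW a).1 b
          split_ifs with h
          · nlinarith [mul_le_mul_of_nonneg_left h.le h1]
          · simpa using mul_nonneg h1 h2
      _ = 1 / θ := by
          rw [Finset.sum_comm]
          simp only [← Finset.sum_div, ← Finset.mul_sum, (hW _).2, mul_one, hP.2]
  set G : A → ℝ := fun a => (∑ b, if W a b ≤ θ * q b then W a b else 0) + φ a with hG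
  have hcode : ∀ c : Fin M → A,
      (1 / (M : ℝ)) * ∑ m, ((∑ b, if dec c b ≠ m then W (c m) b else 0) + φ (c m)) ≤
      (1 / (M : ℝ)) * ∑ m, (G (c m) + ∑ m' ∈ Finset.univ.erase m,
        ∑ b, W (c m) b * (if θ * q b < W (c m') b then (1 : ℝ) else 0)) := by
    intro c
    refine mul_le_mul_of_nonneg_left (Finset.sum_le_sum fun m _ => ?_) (by positivity)
    rw [Finset.sum_comm]
    have := Finset.sum_le_sum fun b (_ : b ∈ Finset.univ) => hpt c m b
    rw [Finset.sum_add_distrib] at this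
    simp only [hG]
    linarith
  have hw := prod_mem_stdSimplex (fun _ : Fin M => P) fun _ => hP
  obtain ⟨c, hc⟩ := exists_le_of_sum_mul_le _ hw (fun c : Fin M → A =>
      (1 / (M : ℝ)) * ∑ m, ((∑ b, if dec c b ≠ m then W (c m) b else 0) + φ (c m)))
      ((∑ a, P a * G a) + (M - 1) / θ) (by
    calc _ ≤ ∑ c : Fin M → A, (∏ k, P (c k)) *
          ((1 / (M : ℝ)) * ∑ m, (G (c m) + ∑ m' ∈ Finset.univ.erase m,
            ∑ b, W (c m) b * (if θ * q b < W (c m') b then (1 : ℝ) else 0))) :=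
          Finset.sum_le_sum fun c _ => mul_le_mul_of_nonneg_left (hcode c) (hw.1 c)
      _ = (1 / (M : ℝ)) * ∑ m, (∑ c : Fin M → A, (∏ k, P (c k)) * G (c m) +
            ∑ m' ∈ Finset.univ.erase m, ∑ c : Fin M → A, (∏ k, P (c k)) *
              ∑ b, W (c m) b * (if θ * q b < W (c m') b then (1 : ℝ) else 0)) := by
          simp only [mul_left_comm _ (1 / (M : ℝ)), ← Finset.mul_sum _ _ (1 / (M : ℝ))]
          congr 1
          simp only [Finset.mul_sum _ _ (∏ k, P _)]
          rw [Finset.sum_comm]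
          refine Finset.sum_congr rfl fun m _ => ?_
          simp only [mul_add, Finset.sum_add_distrib]
          congr 1
          simp only [Finset.mul_sum _ _ (∏ k, P _)]
          rw [Finset.sum_comm]
      _ ≤ (1 / (M : ℝ)) * ∑ m : Fin M, ((∑ a, P a * G a) + (M - 1) / θ) := by
          refine mul_le_mul_of_nonneg_left (Finset.sum_le_sum fun m _ => ?_) (by positivity)
          rw [sum_pi_prod_mul_apply (fun _ => P) (fun _ => hP.2) m G]
          refine add_le_add le_rfl ?_
          refine (Finset.sum_le_sum fun m' hm' =>
            hpair m m' (Finset.ne_of_mem_erase hm').symm).trans_eq ?_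
          rw [Finset.sum_const, Finset.card_erase_of_mem (Finset.mem_univ m), Finset.card_univ,
            Fintype.card_fin, nsmul_eq_mul, Nat.cast_sub hM, Nat.cast_one]
          ring
      _ = _ := by
          rw [Finset.sum_const, Finset.card_univ, Fintype.card_fin, nsmul_eq_mul]
          field_simp)
  exact ⟨c, dec c, hc⟩

namespace Model

/-! ### The empirical input law of a code. -/

section Empirical

variable {X Y S : Type*}

/-- The empirical input law of a code, averaged over messages and positions. -/
def empiricalLaw {M n : ℕ} (c : Code X Y S M n) (x : X) : ℝ := by
  classical
  exact (1 / ((n : ℝ) * (M : ℝ))) * ∑ m, ∑ i, if c.enc m i = x then 1 else 0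

/-- Supplies the absolute continuity that the logarithms in the Fano bound need. -/
theorem empiricalLaw_enc_ne_zero {M n : ℕ} (c : Code X Y S M n) (m : Fin M) (i : Fin n) :
    empiricalLaw c (c.enc m i) ≠ 0 := by
  classical
  have hM : (0 : ℝ) < M := by exact_mod_cast m.pos
  have hn : (0 : ℝ) < n := by exact_mod_cast i.pos
  unfold empiricalLaw
  refine (mul_pos (by positivity) ?_).ne'
  have h0 : ∀ m' i', (0 : ℝ) ≤ if c.enc m' i' = c.enc m i then 1 else 0 := fun m' i' => by
    split_ifs <;> norm_num
  calc (0 : ℝ) < if c.enc m i = c.enc m i then 1 else 0 := by simp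
    _ ≤ ∑ i', if c.enc m i' = c.enc m i then (1 : ℝ) else 0 :=
        Finset.single_le_sum (f := fun i' => if c.enc m i' = c.enc m i then (1 : ℝ) else 0)
          (fun i' _ => h0 m i') (Finset.mem_univ i)
    _ ≤ _ := Finset.single_le_sum
          (f := fun m' => ∑ i', if c.enc m' i' = c.enc m i then (1 : ℝ) else 0)
          (fun m' _ => Finset.sum_nonneg fun i' _ => h0 m' i') (Finset.mem_univ m)

variable [Fintype X]

theorem sum_empiricalLaw_mul {M n : ℕ} (c : Code X Y S M n) (g : X → ℝ) :
    ∑ x, empiricalLaw c x * g x = (1 / ((n : ℝ) * (M : ℝ))) * ∑ m, ∑ i, g (c.enc m i) := by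
  classical
  have : ∀ m i, g (c.enc m i) = ∑ x, (if c.enc m i = x then 1 else 0) * g x := by simp
  simp only [empiricalLaw, this, mul_assoc, ← Finset.mul_sum]
  congr 1
  simp only [Finset.sum_mul]
  rw [Finset.sum_comm]
  exact Finset.sum_congr rfl fun m _ => Finset.sum_comm

theorem empiricalLaw_mem {M n : ℕ} (hM : M ≠ 0) (hn : n ≠ 0) (c : Code X Y S M n) :
    empiricalLaw c ∈ stdSimplex ℝ X := by
  constructor
  · intro x
    unfold empiricalLaw
    refine mul_nonneg (by positivity) (Finset.sum_nonneg fun m _ => Finset.sum_nonneg fun i _ => ?_)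
    split_ifs <;> norm_num
  · have h := sum_empiricalLaw_mul c fun _ => (1 : ℝ)
    simp only [mul_one] at h
    rw [h]
    have hM' : (M : ℝ) ≠ 0 := by exact_mod_cast hM
    have hn' : (n : ℝ) ≠ 0 := by exact_mod_cast hn
    simp
    field_simp

end Empirical

/-! ### Block laws, error and distortion. -/

variable {X Y S : Type*} [Fintype Y] [Fintype S]

theorem marginal_mem (K : Model X Y S) (x : X) : K.marginal x ∈ stdSimplex ℝ Y := by
  refine ⟨fun y => Finset.sum_nonneg fun s _ => mul_nonneg (K.PS_mem.1 s) ((K.W_mem x s).1 y), ?_⟩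
  simp only [marginal]
  rw [Finset.sum_comm]
  simp only [← Finset.mul_sum, (K.W_mem _ _).2, mul_one, K.PS_mem.2]

theorem joint_mem (K : Model X Y S) (x : X) :
    (fun z : S × Y => K.PS z.1 * K.W x z.1 z.2) ∈ stdSimplex ℝ (S × Y) := by
  refine ⟨fun z => mul_nonneg (K.PS_mem.1 _) ((K.W_mem _ _).1 _), ?_⟩
  rw [Fintype.sum_prod_type]
  simp only [← Finset.mul_sum, (K.W_mem _ _).2, mul_one, K.PS_mem.2]

theorem sum_blockProb (K : Model X Y S) {n : ℕ} (x : Fin n → X) (y : Fin n → Y) :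
    ∑ s, K.blockProb x s y = ∏ i, K.marginal (x i) (y i) := by
  simp only [blockProb, ← Finset.prod_mul_distrib, marginal]
  exact sum_pi_prod fun k s => K.PS s * K.W (x k) s (y k)

theorem sum_sum_blockProb_mul (K : Model X Y S) {n : ℕ} (x : Fin n → X)
    (f : (Fin n → S) → (Fin n → Y) → ℝ) :
    ∑ s, ∑ y, K.blockProb x s y * f s y =
      ∑ z : Fin n → S × Y, (∏ k, K.PS (z k).1 * K.W (x k) (z k).1 (z k).2) *
        f (fun i => (z i).1) (fun i => (z i).2) := by
  rw [← Fintype.sum_prod_type', ← (Equiv.arrowProdEquivProdArrow (Fin n) (fun _ => S)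
    (fun _ => Y)).sum_comp]
  simp only [blockProb, ← Finset.prod_mul_distrib]
  rfl

theorem errorProb_eq (K : Model X Y S) {M n : ℕ} (c : Code X Y S M n) :
    K.errorProb c = (1 / (M : ℝ)) * ∑ m, ∑ y : Fin n → Y,
      if c.dec y ≠ m then ∏ i, K.marginal (c.enc m i) (y i) else 0 := by
  unfold errorProb
  congr 1
  refine Finset.sum_congr rfl fun m _ => ?_
  rw [Finset.sum_comm]
  refine Finset.sum_congr rfl fun y _ => ?_
  rw [← sum_blockProb]
  split_ifs <;> simp

theorem avgDistortion_eq (K : Model X Y S) {M n : ℕ} (c : Code X Y S M n) :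
    K.avgDistortion c = (1 / (M : ℝ)) * ∑ m, (1 / (n : ℝ)) * ∑ i,
      ∑ s, ∑ y, K.blockProb (c.enc m) s y * K.d (s i) (c.est y i) := by
  unfold avgDistortion
  congr 1
  refine Finset.sum_congr rfl fun m _ => ?_
  simp only [mul_left_comm _ (1 / (n : ℝ)), ← Finset.mul_sum _ _ (1 / (n : ℝ))]
  congr 1
  simp only [Finset.mul_sum]
  conv_rhs => rw [Finset.sum_comm]
  refine Finset.sum_congr rfl fun s _ => ?_
  rw [Finset.sum_comm]

theorem blockProb_nonneg (K : Model X Y S) {n : ℕ} (x : Fin n → X) (s : Fin n → S)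
    (y : Fin n → Y) : 0 ≤ K.blockProb x s y :=
  mul_nonneg (Finset.prod_nonneg fun _ _ => K.PS_mem.1 _)
    (Finset.prod_nonneg fun _ _ => (K.W_mem _ _).1 _)

theorem sum_sum_blockProb (K : Model X Y S) {n : ℕ} (x : Fin n → X) :
    ∑ s, ∑ y, K.blockProb x s y = 1 := by
  rw [Finset.sum_comm]
  simp only [sum_blockProb]
  exact (prod_mem_stdSimplex _ fun i => K.marginal_mem (x i)).2

theorem errorProb_nonneg (K : Model X Y S) {M n : ℕ} (c : Code X Y S M n) :
    0 ≤ K.errorProb c := by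
  refine mul_nonneg (by positivity) (Finset.sum_nonneg fun m _ => Finset.sum_nonneg fun s _ =>
    Finset.sum_nonneg fun y _ => ?_)
  split_ifs
  · exact K.blockProb_nonneg _ _ _
  · exact le_rfl

theorem avgDistortion_nonneg (K : Model X Y S) {M n : ℕ} (c : Code X Y S M n) :
    0 ≤ K.avgDistortion c :=
  mul_nonneg (by positivity) (Finset.sum_nonneg fun m _ => Finset.sum_nonneg fun s _ =>
    Finset.sum_nonneg fun y _ => mul_nonneg (K.blockProb_nonneg _ _ _)
      (mul_nonneg (by positivity) (Finset.sum_nonneg fun _ _ => K.d_nonneg _ _)))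

theorem avgCost_nonneg (K : Model X Y S) {M n : ℕ} (c : Code X Y S M n) : 0 ≤ K.avgCost c :=
  mul_nonneg (by positivity) (Finset.sum_nonneg fun _ _ => Finset.sum_nonneg fun _ _ =>
    K.v_nonneg _)

theorem exists_forall_d_le (K : Model X Y S) : ∃ B, 0 ≤ B ∧ ∀ s s', K.d s s' ≤ B := by
  refine ⟨∑ s, ∑ s', K.d s s', Finset.sum_nonneg fun s _ => Finset.sum_nonneg fun s' _ =>
    K.d_nonneg s s', fun s s' => ?_⟩
  refine (Finset.single_le_sum (f := fun s' => K.d s s') (fun s' _ => K.d_nonneg s s')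
    (Finset.mem_univ s')).trans ?_
  exact Finset.single_le_sum (f := fun s => ∑ s', K.d s s')
    (fun s _ => Finset.sum_nonneg fun s' _ => K.d_nonneg s s') (Finset.mem_univ s)

theorem avgDistortion_le_of_forall_d_le (K : Model X Y S) {B : ℝ} (hB : ∀ s s', K.d s s' ≤ B)
    {M n : ℕ} (hM : M ≠ 0) (hn : n ≠ 0) (c : Code X Y S M n) : K.avgDistortion c ≤ B := by
  rw [avgDistortion_eq]
  calc _ ≤ (1 / (M : ℝ)) * ∑ _m : Fin M, (1 / (n : ℝ)) * ∑ _i : Fin n, B := by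
        refine mul_le_mul_of_nonneg_left (Finset.sum_le_sum fun m _ => ?_) (by positivity)
        refine mul_le_mul_of_nonneg_left (Finset.sum_le_sum fun i _ => ?_) (by positivity)
        calc _ ≤ ∑ s, ∑ y, K.blockProb (c.enc m) s y * B :=
              Finset.sum_le_sum fun s _ => Finset.sum_le_sum fun y _ =>
                mul_le_mul_of_nonneg_left (hB _ _) (K.blockProb_nonneg _ _ _)
          _ = B := by simp only [← Finset.sum_mul, sum_sum_blockProb, one_mul]
    _ = B := by
        simp only [Finset.sum_const, Finset.card_univ, Fintype.card_fin, nsmul_eq_mul]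
        field_simp

/-! ### Output law and mutual information. -/

variable [Fintype X]

/-- The output law induced by the input law `P`. -/
def outputLaw (K : Model X Y S) (P : X → ℝ) (y : Y) : ℝ :=
  ∑ x, P x * K.marginal x y

theorem outputLaw_mem (K : Model X Y S) {P : X → ℝ} (hP : P ∈ stdSimplex ℝ X) :
    K.outputLaw P ∈ stdSimplex ℝ Y := by
  refine ⟨fun y => Finset.sum_nonneg fun x _ => mul_nonneg (hP.1 x) ((K.marginal_mem x).1 y), ?_⟩
  simp only [outputLaw]
  rw [Finset.sum_comm]
  simp only [← Finset.mul_sum, (K.marginal_mem _).2, mul_one, hP.2]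

theorem outputLaw_pos (K : Model X Y S) {P : X → ℝ} (hP : P ∈ stdSimplex ℝ X) {x : X} {y : Y}
    (hx : P x ≠ 0) (hy : K.marginal x y ≠ 0) : 0 < K.outputLaw P y := by
  have h := fun x => mul_nonneg (hP.1 x) ((K.marginal_mem x).1 y)
  have h0 : 0 < P x * K.marginal x y := lt_of_le_of_ne (h x) (mul_ne_zero hx hy).symm
  exact h0.trans_le (Finset.single_le_sum (f := fun x => P x * K.marginal x y)
    (fun x _ => h x) (Finset.mem_univ x))

theorem inputInfo_eq (K : Model X Y S) (P : X → ℝ) :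
    K.inputInfo P = ∑ x, P x * ∑ y, K.marginal x y *
      Real.log (K.marginal x y / K.outputLaw P y) := by
  unfold inputInfo mutualInfo
  refine Finset.sum_congr rfl fun x _ => ?_
  rw [Finset.mul_sum]
  refine Finset.sum_congr rfl fun y _ => ?_
  rw [← Finset.mul_sum, (K.marginal_mem x).2, mul_one]
  by_cases hx : P x = 0
  · simp [hx]
  · rw [mul_div_mul_left _ _ hx, mul_assoc]
    rfl

/-- The form H(Y) − H(Y|X) has no quotient and is built from the continuous `negMulLog`, so
continuity follows up to the boundary of the simplex. -/
theorem inputInfo_eq_entropy (K : Model X Y S) {P : X → ℝ} (hP : P ∈ stdSimplex ℝ X) :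
    K.inputInfo P = (∑ y, Real.negMulLog (K.outputLaw P y)) -
      ∑ x, P x * ∑ y, Real.negMulLog (K.marginal x y) := by
  have h : ∀ x y, P x * (K.marginal x y * Real.log (K.marginal x y / K.outputLaw P y)) =
      P x * K.marginal x y * (-Real.log (K.outputLaw P y)) -
        P x * Real.negMulLog (K.marginal x y) := by
    intro x y
    by_cases hx : P x = 0
    · simp [hx]
    by_cases hy : K.marginal x y = 0
    · simp [hy]
    rw [Real.log_div hy (K.outputLaw_pos hP hx hy).ne', Real.negMulLog]
    ring
  rw [inputInfo_eq]
  simp only [Finset.mul_sum, h, Finset.sum_sub_distrib]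
  congr 1
  rw [Finset.sum_comm]
  refine Finset.sum_congr rfl fun y _ => ?_
  rw [← Finset.sum_mul, Real.negMulLog]
  simp only [outputLaw]
  ring

theorem continuousOn_inputInfo (K : Model X Y S) :
    ContinuousOn K.inputInfo (stdSimplex ℝ X) := by
  refine ContinuousOn.congr (f := fun P => (∑ y, Real.negMulLog (K.outputLaw P y)) -
      ∑ x, P x * ∑ y, Real.negMulLog (K.marginal x y)) ?_ fun P hP => K.inputInfo_eq_entropy hP
  apply Continuous.continuousOn
  unfold outputLaw
  refine Continuous.sub (continuous_finsetSum _ fun y _ => Real.continuous_negMulLog.comp ?_) ?_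
  all_goals fun_prop

theorem avgCost_eq_sum_empiricalLaw (K : Model X Y S) {M n : ℕ} (c : Code X Y S M n) :
    K.avgCost c = ∑ x, empiricalLaw c x * K.v x :=
  (sum_empiricalLaw_mul c K.v).symm

/-! ### Estimation cost and the converse. -/

theorem estCost_le (K : Model X Y S) (x : X) (g : Y → S) :
    K.estCost x ≤ ∑ z : S × Y, (K.PS z.1 * K.W x z.1 z.2) * K.d z.1 (g z.2) := by
  classical
  rw [Fintype.sum_prod_type]
  exact ciInf_le (Set.finite_range fun h : X × Y → S =>
    ∑ s, ∑ y, K.PS s * K.W x s y * K.d s (h (x, y))).bddBelow fun p => g p.2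

/-- The minimizations for different `x` do not interact, so the diagonal of the minimizers is
optimal for every `x` at once. -/
theorem exists_estCost_eq [Nonempty X] (K : Model X Y S) : ∃ h : X → Y → S, ∀ x,
    ∑ z : S × Y, (K.PS z.1 * K.W x z.1 z.2) * K.d z.1 (h x z.2) = K.estCost x := by
  classical
  have hS : Nonempty S := by
    by_contra hS
    rw [not_nonempty_iff] at hS
    simpa using K.PS_mem.2
  have : ∀ x, ∃ h : X × Y → S,
      ∑ s, ∑ y, K.PS s * K.W x s y * K.d s (h (x, y)) = K.estCost x := fun x =>
    exists_eq_ciInf_of_finite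
  choose h hh using this
  refine ⟨fun x y => h x (x, y), fun x => ?_⟩
  rw [Fintype.sum_prod_type, ← hh]

/-- By memorylessness, the pair at position `i` can be resampled with all others fixed; the estimate
at `i` is then a function of the output at `i` alone and costs at least `estCost`. -/
theorem sum_empiricalLaw_mul_estCost_le (K : Model X Y S) {M n : ℕ} (c : Code X Y S M n) :
    ∑ x, empiricalLaw c x * K.estCost x ≤ K.avgDistortion c := by
  classical
  rw [sum_empiricalLaw_mul, avgDistortion_eq, ← Finset.mul_sum, ← mul_assoc,
    one_div_mul_one_div, mul_comm (n : ℝ)]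
  refine mul_le_mul_of_nonneg_left (Finset.sum_le_sum fun m _ => Finset.sum_le_sum fun i _ => ?_)
    (by positivity)
  rw [sum_sum_blockProb_mul K (c.enc m) fun s y => K.d (s i) (c.est y i)]
  refine le_sum_pi_prod_mul (fun k (z : S × Y) => K.PS z.1 * K.W (c.enc m k) z.1 z.2)
    (fun k => K.joint_mem _) i
    (fun z => K.d (z i).1 (c.est (fun j => (z j).2) i)) _ fun z => ?_
  refine (K.estCost_le (c.enc m i)
    fun y => c.est (Function.update (fun j => (z j).2) i y) i).trans_eq ?_
  refine Finset.sum_congr rfl fun a _ => ?_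
  have : (fun j => (Function.update z i a j).2) = Function.update (fun j => (z j).2) i a.2 := by
    ext j
    by_cases hj : j = i
    · subst hj; simp
    · simp [hj]
  simp only [this, Function.update_self]

/-- This is `log u ≤ u - 1` at `u = r * t / w`: a pointwise variational lower bound for relative
entropy with test function `t`. -/
theorem mul_log_add_sub_le {w r t : ℝ} (hw : 0 ≤ w) (hr : 0 ≤ r) (hrw : w ≠ 0 → r ≠ 0)
    (ht : 0 < t) : w * Real.log t + w - r * t ≤ w * Real.log (w / r) := by
  rcases hw.eq_or_lt with rfl | hw'
  · simp
    positivity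
  have hr' : 0 < r := lt_of_le_of_ne hr (hrw hw'.ne').symm
  have h := Real.log_le_sub_one_of_pos (show 0 < r * t / w by positivity)
  rw [Real.log_div (by positivity) hw'.ne', Real.log_mul hr'.ne' ht.ne'] at h
  rw [Real.log_div hw'.ne' hr'.ne']
  have h2 := mul_le_mul_of_nonneg_left h hw
  have h3 : w * (r * t / w - 1) = r * t - w := by field_simp
  linarith

/-- A Fano-type bound for the empirical input law of a code. -/
theorem one_sub_errorProb_mul_log_le (K : Model X Y S) {M n : ℕ} (hM : M ≠ 0) (hn : n ≠ 0)
    (c : Code X Y S M n) :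
    (1 - K.errorProb c) * Real.log M ≤ n * K.inputInfo (empiricalLaw c) + 1 := by
  classical
  set Q := empiricalLaw c with hQ
  have hQm : Q ∈ stdSimplex ℝ X := empiricalLaw_mem hM hn c
  have hMr : (0 : ℝ) < M := by positivity
  have hnr : (0 : ℝ) < n := by positivity
  set w : Fin M → (Fin n → Y) → ℝ := fun m y => ∏ i, K.marginal (c.enc m i) (y i) with hwdef
  set r : (Fin n → Y) → ℝ := fun y => ∏ i, K.outputLaw Q (y i) with hrdef
  have hw : ∀ m, w m ∈ stdSimplex ℝ (Fin n → Y) := fun m =>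
    prod_mem_stdSimplex _ fun i => K.marginal_mem (c.enc m i)
  have hr : r ∈ stdSimplex ℝ (Fin n → Y) := prod_mem_stdSimplex _ fun i => K.outputLaw_mem hQm
  have hpos : ∀ m y, w m y ≠ 0 → ∀ i, K.marginal (c.enc m i) (y i) ≠ 0 ∧
      K.outputLaw Q (y i) ≠ 0 := by
    intro m y h i
    have h1 := Finset.prod_ne_zero_iff.1 h i (Finset.mem_univ i)
    exact ⟨h1, (K.outputLaw_pos hQm (empiricalLaw_enc_ne_zero c m i) h1).ne'⟩
  have hdiv : ∀ m, ∑ y, w m y * Real.log (w m y / r y) = ∑ i, ∑ b,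
      K.marginal (c.enc m i) b * Real.log (K.marginal (c.enc m i) b / K.outputLaw Q b) := by
    intro m
    have h1 : ∀ y, w m y * Real.log (w m y / r y) = ∑ i, w m y *
        Real.log (K.marginal (c.enc m i) (y i) / K.outputLaw Q (y i)) := by
      intro y
      by_cases h : w m y = 0
      · simp [h]
      rw [← Finset.mul_sum, ← Real.log_prod fun i _ =>
        div_ne_zero (hpos m y h i).1 (hpos m y h i).2, Finset.prod_div_distrib]
    simp only [h1]
    rw [Finset.sum_comm]
    refine Finset.sum_congr rfl fun i _ => ?_
    exact sum_pi_prod_mul_apply (fun k => K.marginal (c.enc m k))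
      (fun k => (K.marginal_mem _).2) i
      (fun b => Real.log (K.marginal (c.enc m i) b / K.outputLaw Q b))
  -- Since `r` is a power of the output law of `Q`, the divergences average to exactly `n *
  -- inputInfo Q`; no concavity argument is needed.
  have hI : ∑ m, ∑ y, w m y * Real.log (w m y / r y) = M * (n * K.inputInfo Q) := by
    simp only [hdiv]
    rw [inputInfo_eq, sum_empiricalLaw_mul c fun x => ∑ b, K.marginal x b *
      Real.log (K.marginal x b / K.outputLaw Q b)]
    field_simp
  -- The test function rewards correct decoding. Each `y` decodes to one message, so `t` sums over
  -- messages to at most `2 * M`, which costs the additive 1 in the conclusion.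
  set t : Fin M → (Fin n → Y) → ℝ := fun m y => if c.dec y = m then (M : ℝ) else 1 with ht
  have htpos : ∀ m y, 0 < t m y := fun m y => by
    simp only [ht]
    split_ifs <;> positivity
  have hge : ∑ m, ∑ y, (w m y * Real.log (t m y) + w m y - r y * t m y) ≤
      ∑ m, ∑ y, w m y * Real.log (w m y / r y) :=
    Finset.sum_le_sum fun m _ => Finset.sum_le_sum fun y _ =>
      mul_log_add_sub_le ((hw m).1 y) (hr.1 y)
        (fun h => Finset.prod_ne_zero_iff.2 fun i _ => (hpos m y h i).2) (htpos m y)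
  have ht_le : ∑ m, ∑ y, r y * t m y ≤ 2 * M := by
    rw [Finset.sum_comm]
    calc ∑ y, ∑ m, r y * t m y ≤ ∑ y, r y * (2 * M) := by
          refine Finset.sum_le_sum fun y _ => ?_
          rw [← Finset.mul_sum]
          refine mul_le_mul_of_nonneg_left ?_ (hr.1 y)
          calc ∑ m, t m y ≤ ∑ m, ((if c.dec y = m then (M : ℝ) else 0) + 1) := by
                refine Finset.sum_le_sum fun m _ => ?_
                simp only [ht]
                split_ifs <;> simp
            _ = 2 * M := by
                rw [Finset.sum_add_distrib]
                simp
                ring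
      _ = 2 * M := by rw [← Finset.sum_mul, hr.2, one_mul]
  have herr : ∑ m, ∑ y, w m y * Real.log (t m y) =
      M * ((1 - K.errorProb c) * Real.log M) := by
    have h1 : ∀ m y, w m y * Real.log (t m y) =
        (w m y - if c.dec y ≠ m then w m y else 0) * Real.log M := by
      intro m y
      by_cases h : c.dec y = m <;> simp [ht, h]
    simp only [h1, ← Finset.sum_mul, Finset.sum_sub_distrib, (hw _).2]
    rw [errorProb_eq]
    simp only [Finset.sum_const, Finset.card_univ, Fintype.card_fin, nsmul_eq_mul, mul_one]
    field_simp
    exact mul_comm _ _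
  have hw1 : ∑ m, ∑ y, w m y = M := by simp [(hw _).2]
  simp only [Finset.sum_sub_distrib, Finset.sum_add_distrib] at hge
  rw [herr, hI, hw1] at hge
  have : (M : ℝ) * ((1 - K.errorProb c) * Real.log M) ≤ M * (n * K.inputInfo Q + 1) := by
    linarith
  exact le_of_mul_le_mul_left this hMr

theorem ceil_exp_ne_zero (t : ℝ) : ⌈Real.exp t⌉₊ ≠ 0 :=
  (Nat.ceil_pos.2 (Real.exp_pos t)).ne'

theorem exists_le_inputInfo_of_achievable (K : Model X Y S) {R D V : ℝ}
    (h : K.Achievable R D V) :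
    ∃ P ∈ K.estSet D ∩ K.costSet V, R ≤ K.inputInfo P := by
  obtain ⟨c, herr, hdist, hcost⟩ := h
  have hM : ∀ n : ℕ, ⌈Real.exp ((n : ℝ) * R)⌉₊ ≠ 0 := fun n => ceil_exp_ne_zero _
  obtain ⟨B, -, hB⟩ := K.exists_forall_d_le
  -- The shift avoids block length 0, where the empirical law is not a PMF.
  have hmem : ∀ n, empiricalLaw (c (n + 1)) ∈ stdSimplex ℝ X := fun n =>
    empiricalLaw_mem (hM _) n.succ_ne_zero _
  obtain ⟨P, hP, φ, hφ, hlim⟩ := (isCompact_stdSimplex ℝ X).tendsto_subseq hmem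
  have hsub : Tendsto (fun k => φ k + 1) atTop atTop :=
    (tendsto_add_atTop_nat 1).comp hφ.tendsto_atTop
  have hlin : ∀ g : X → ℝ, Tendsto (fun k => ∑ x, empiricalLaw (c (φ k + 1)) x * g x) atTop
      (𝓝 (∑ x, P x * g x)) := fun g =>
    tendsto_finsetSum _ fun x _ => ((tendsto_pi_nhds.1 hlim x).mul_const _)
  -- A real `limsup` bounds the terms eventually only for sequences bounded above.
  have hbd : IsBoundedUnder (· ≤ ·) atTop fun n => K.avgDistortion (c n) :=
    isBoundedUnder_of_eventually_le (a := B) ((eventually_ne_atTop 0).mono fun n hn =>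
      K.avgDistortion_le_of_forall_d_le hB (hM n) hn _)
  have hbc : IsBoundedUnder (· ≤ ·) atTop fun n => K.avgCost (c n) := by
    refine isBoundedUnder_of_eventually_le (a := ∑ x, K.v x) ((eventually_ne_atTop 0).mono
      fun n hn => ?_)
    rw [avgCost_eq_sum_empiricalLaw]
    have hm := empiricalLaw_mem (hM n) hn (c n)
    refine Finset.sum_le_sum fun x _ => mul_le_of_le_one_left (K.v_nonneg x) ?_
    rw [← hm.2]
    exact Finset.single_le_sum (fun x _ => hm.1 x) (Finset.mem_univ x)
  refine ⟨P, ⟨⟨hP, ?_⟩, ⟨hP, ?_⟩⟩, ?_⟩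
  · refine le_of_forall_pos_le_add fun ε hε => ?_
    refine le_of_tendsto (hlin K.estCost) ?_
    filter_upwards [hsub.eventually (eventually_lt_of_limsup_lt
      (hdist.trans_lt (lt_add_of_pos_right D hε)) hbd)] with k hk
    exact (K.sum_empiricalLaw_mul_estCost_le _).trans hk.le
  · refine le_of_forall_pos_le_add fun ε hε => ?_
    refine le_of_tendsto (hlin K.v) ?_
    filter_upwards [hsub.eventually (eventually_lt_of_limsup_lt
      (hcost.trans_lt (lt_add_of_pos_right V hε)) hbc)] with k hk
    rw [← avgCost_eq_sum_empiricalLaw]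
    exact hk.le
  · have hI : Tendsto (fun k => K.inputInfo (empiricalLaw (c (φ k + 1)))) atTop
        (𝓝 (K.inputInfo P)) :=
      (K.continuousOn_inputInfo P hP).tendsto.comp
        (tendsto_nhdsWithin_iff.2 ⟨hlim, Eventually.of_forall fun k => hmem _⟩)
    have hrhs : Tendsto (fun k => K.inputInfo (empiricalLaw (c (φ k + 1))) +
        1 / ((φ k + 1 : ℕ) : ℝ)) atTop (𝓝 (K.inputInfo P + 0)) :=
      hI.add (tendsto_one_div_atTop_nhds_zero_nat.comp hsub)
    have hlhs : Tendsto (fun k => (1 - K.errorProb (c (φ k + 1))) * R) atTop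
        (𝓝 ((1 - 0) * R)) :=
      ((herr.comp hsub).const_sub 1).mul_const R
    rw [add_zero] at hrhs
    rw [sub_zero, one_mul] at hlhs
    refine le_of_tendsto_of_tendsto hlhs hrhs ?_
    filter_upwards [hsub.eventually (herr.eventually (gt_mem_nhds one_pos))] with k hk
    have hn : (0 : ℝ) < ((φ k + 1 : ℕ) : ℝ) := by positivity
    have h1 := K.one_sub_errorProb_mul_log_le (hM (φ k + 1)) (φ k).succ_ne_zero (c (φ k + 1))
    have h2 : ((φ k + 1 : ℕ) : ℝ) * R ≤
        Real.log (⌈Real.exp (((φ k + 1 : ℕ) : ℝ) * R)⌉₊ : ℝ) := by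
      rw [Real.le_log_iff_exp_le (by exact_mod_cast Nat.pos_of_ne_zero (hM _))]
      exact Nat.le_ceil _
    have h3 := (mul_le_mul_of_nonneg_left h2 (sub_nonneg.2 hk.le)).trans h1
    rw [← mul_le_mul_iff_right₀ hn, mul_add, mul_one_div_cancel hn.ne']
    linarith

/-! ### Achievability. -/

/-- Chebyshev bound for the probability that the information density is at most `τ` per symbol. -/
theorem sum_threshold_le (K : Model X Y S) {P : X → ℝ} (hP : P ∈ stdSimplex ℝ X) {τ : ℝ}
    (hτ : τ < K.inputInfo P) : ∃ C, ∀ n : ℕ, n ≠ 0 →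
      ∑ x : Fin n → X, (∏ i, P (x i)) * ∑ y : Fin n → Y,
        (if ∏ i, K.marginal (x i) (y i) ≤ Real.exp (n * τ) * ∏ i, K.outputLaw P (y i)
          then ∏ i, K.marginal (x i) (y i) else 0) ≤ C / n := by
  set I := K.inputInfo P with hI
  set p : X × Y → ℝ := fun z => P z.1 * K.marginal z.1 z.2 with hp
  set f : X × Y → ℝ := fun z => Real.log (K.marginal z.1 z.2 / K.outputLaw P z.2) with hf
  have hmean : ∑ z, p z * f z = I := by
    rw [hI, inputInfo_eq, Fintype.sum_prod_type]
    simp only [hp, hf, Finset.mul_sum, mul_assoc]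
  have hp0 : ∀ z, 0 ≤ p z := fun z => mul_nonneg (hP.1 _) ((K.marginal_mem _).1 _)
  have hp1 : ∑ z, p z = 1 := by
    rw [Fintype.sum_prod_type]
    simp only [hp, ← Finset.mul_sum, (K.marginal_mem _).2, mul_one, hP.2]
  have hgap : 0 < I - τ := sub_pos.2 hτ
  refine ⟨(∑ z, p z * (f z - I) ^ 2) / (I - τ) ^ 2, fun n hn => ?_⟩
  have hnr : (0 : ℝ) < n := by positivity
  have hvar := sum_pi_prod_mul_sq_average_sub p hp1 f hn
  rw [hmean] at hvar
  have hpt : ∀ z : Fin n → X × Y,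
      (∏ i, P (z i).1) * (if ∏ i, K.marginal (z i).1 (z i).2 ≤
          Real.exp (n * τ) * ∏ i, K.outputLaw P (z i).2
        then ∏ i, K.marginal (z i).1 (z i).2 else 0) ≤
      (∏ i, p (z i)) * ((1 / (n : ℝ)) * ∑ i, f (z i) - I) ^ 2 / (I - τ) ^ 2 := by
    intro z
    have hpz : 0 ≤ ∏ i, p (z i) := Finset.prod_nonneg fun i _ => hp0 _
    have hprod : (∏ i, P (z i).1) * ∏ i, K.marginal (z i).1 (z i).2 = ∏ i, p (z i) :=
      Finset.prod_mul_distrib.symm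
    split_ifs with h
    · rw [hprod, le_div_iff₀ (by positivity)]
      rcases hpz.eq_or_lt with h0 | hpos
      · rw [← h0]; simp
      refine mul_le_mul_of_nonneg_left ?_ hpz
      have hne : ∀ i, P (z i).1 ≠ 0 ∧ K.marginal (z i).1 (z i).2 ≠ 0 := fun i =>
        mul_ne_zero_iff.1 (Finset.prod_ne_zero_iff.1 hpos.ne' i (Finset.mem_univ i))
      have hq : ∀ i, K.outputLaw P (z i).2 ≠ 0 := fun i =>
        (K.outputLaw_pos hP (hne i).1 (hne i).2).ne'
      have hqpos : 0 < ∏ i, K.outputLaw P (z i).2 := Finset.prod_pos fun i _ =>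
        K.outputLaw_pos hP (hne i).1 (hne i).2
      have hWpos : 0 < ∏ i, K.marginal (z i).1 (z i).2 := Finset.prod_pos fun i _ =>
        lt_of_le_of_ne ((K.marginal_mem _).1 _) (hne i).2.symm
      -- Below the threshold, the mean information density misses `I` by at least `I - τ`.
      have hsum : ∑ i, f (z i) ≤ n * τ := by
        simp only [hf]
        rw [← Real.log_prod fun i _ => div_ne_zero (hne i).2 (hq i), Finset.prod_div_distrib,
          Real.log_le_iff_le_exp (by positivity), div_le_iff₀ hqpos]
        exact h
      have h2 : (1 / (n : ℝ)) * ∑ i, f (z i) ≤ τ := by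
        rw [one_div_mul_eq_div, div_le_iff₀ hnr, mul_comm]
        exact hsum
      nlinarith
    · rw [mul_zero]
      positivity
  calc _ = ∑ z : Fin n → X × Y, (∏ i, P (z i).1) *
        (if ∏ i, K.marginal (z i).1 (z i).2 ≤
          Real.exp (n * τ) * ∏ i, K.outputLaw P (z i).2
        then ∏ i, K.marginal (z i).1 (z i).2 else 0) := by
        simp only [Finset.mul_sum]
        rw [← Fintype.sum_prod_type', ← (Equiv.arrowProdEquivProdArrow (Fin n) (fun _ => X)
          (fun _ => Y)).sum_comp]
        rfl
    _ ≤ _ := Finset.sum_le_sum fun z _ => hpt z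
    _ = _ := by
        rw [← Finset.sum_div, hvar]
        ring

/-- Estimating each state from the output and the decoded codeword loses at most
the worst-case distortion on decoding errors. -/
theorem avgDistortion_le_of_est_eq (K : Model X Y S) {B : ℝ} (hB : ∀ s s', K.d s s' ≤ B)
    {h : X → Y → S}
    (hh : ∀ x, ∑ z : S × Y, (K.PS z.1 * K.W x z.1 z.2) * K.d z.1 (h x z.2) = K.estCost x)
    {M n : ℕ} (hn : n ≠ 0) (c : Code X Y S M n)
    (hest : ∀ y i, c.est y i = h (c.enc (c.dec y) i) (y i)) :
    K.avgDistortion c ≤ ∑ x, empiricalLaw c x * K.estCost x + B * K.errorProb c := by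
  have hterm : ∀ m i, ∑ s, ∑ y, K.blockProb (c.enc m) s y * K.d (s i) (c.est y i) ≤
      K.estCost (c.enc m i) +
        B * ∑ s, ∑ y, if c.dec y ≠ m then K.blockProb (c.enc m) s y else 0 := by
    intro m i
    have h1 : ∑ s, ∑ y, K.blockProb (c.enc m) s y * K.d (s i) (h (c.enc m i) (y i)) =
        K.estCost (c.enc m i) := by
      rw [sum_sum_blockProb_mul K (c.enc m) fun s y => K.d (s i) (h (c.enc m i) (y i)),
        sum_pi_prod_mul_apply (fun k (z : S × Y) => K.PS z.1 * K.W (c.enc m k) z.1 z.2)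
        (fun k => (K.joint_mem _).2) i (fun z => K.d z.1 (h (c.enc m i) z.2)), hh]
    rw [← h1]
    simp only [Finset.mul_sum, ← Finset.sum_add_distrib]
    refine Finset.sum_le_sum fun s _ => Finset.sum_le_sum fun y _ => ?_
    have hb := K.blockProb_nonneg (c.enc m) s y
    by_cases hm : c.dec y = m
    · simp [hest, hm]
    · rw [if_pos hm, mul_comm B]
      exact (mul_le_mul_of_nonneg_left (hB _ _) hb).trans
        (le_add_of_nonneg_left (mul_nonneg hb (K.d_nonneg _ _)))
  have hnr : (n : ℝ) ≠ 0 := by exact_mod_cast hn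
  rw [avgDistortion_eq, sum_empiricalLaw_mul, errorProb]
  calc _ ≤ (1 / (M : ℝ)) * ∑ m, (1 / (n : ℝ)) * ∑ i, (K.estCost (c.enc m i) +
        B * ∑ s, ∑ y, if c.dec y ≠ m then K.blockProb (c.enc m) s y else 0) := by
        refine mul_le_mul_of_nonneg_left (Finset.sum_le_sum fun m _ => ?_) (by positivity)
        exact mul_le_mul_of_nonneg_left (Finset.sum_le_sum fun i _ => hterm m i) (by positivity)
    _ = _ := by
        simp only [Finset.sum_add_distrib, mul_add, Finset.sum_const, Finset.card_univ,
          Fintype.card_fin, nsmul_eq_mul]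
        congr 1
        · rw [← Finset.mul_sum, ← mul_assoc, one_div_mul_one_div, mul_comm (M : ℝ)]
        · simp only [one_div_mul_eq_div, mul_div_cancel_left₀ _ hnr, ← Finset.mul_sum]
          ring

/-- Cauchy–Schwarz, used to turn the quadratic penalties back into bounds on average costs. -/
theorem average_le_sqrt_of_average_sq_le {M : ℕ} (a : Fin M → ℝ) {ε : ℝ}
    (h : (1 / (M : ℝ)) * ∑ m, a m ^ 2 ≤ ε) : (1 / (M : ℝ)) * ∑ m, a m ≤ √ε := by
  refine Real.le_sqrt_of_sq_le (le_trans ?_ h)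
  rcases Nat.eq_zero_or_pos M with rfl | hM
  · simp
  have hM' : (0 : ℝ) < M := by exact_mod_cast hM
  have h1 := sq_sum_le_card_mul_sum_sq (s := Finset.univ) (f := a)
  rw [Finset.card_univ, Fintype.card_fin] at h1
  rw [mul_pow, one_div_pow, one_div_mul_eq_div, div_le_iff₀ (by positivity)]
  calc _ ≤ _ := h1
    _ = _ := by field_simp

theorem limsup_le_of_le_add {f e : ℕ → ℝ} {a : ℝ} (hf : ∀ n, 0 ≤ f n)
    (he : Tendsto e atTop (𝓝 0)) (h : ∀ᶠ n in atTop, f n ≤ a + e n) :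
    limsup f atTop ≤ a := by
  refine le_of_forall_pos_le_add fun ε hε => ?_
  refine limsup_le_of_le (isCoboundedUnder_le_of_le atTop hf) ?_
  filter_upwards [h, he.eventually (gt_mem_nhds hε)] with n h1 h2
  linarith

/-- The rate enters only through `hrate`, so that both `R < τ` and the single-message case `R = 0`
are covered. -/
theorem achievable_of_tendsto (K : Model X Y S) {P : X → ℝ} {R D V τ : ℝ}
    (hPD : P ∈ K.estSet D) (hPV : P ∈ K.costSet V) (hτ : τ < K.inputInfo P)
    (hrate : Tendsto (fun n : ℕ => ((⌈Real.exp ((n : ℝ) * R)⌉₊ : ℝ) - 1) / Real.exp (n * τ))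
      atTop (𝓝 0)) : K.Achievable R D V := by
  have hP := hPD.1
  have hX : Nonempty X := by
    by_contra hX
    rw [not_nonempty_iff] at hX
    simpa using hP.2
  obtain ⟨h, hh⟩ := K.exists_estCost_eq
  obtain ⟨B, hB0, hB⟩ := K.exists_forall_d_le
  obtain ⟨C, hC⟩ := K.sum_threshold_le hP hτ
  set μ₁ := ∑ x, P x * K.estCost x with hμ₁
  set μ₂ := ∑ x, P x * K.v x with hμ₂
  -- Squared deviations are nonnegative, so a bound on the sum of error and penalties bounds each
  -- term.
  set φ₁ : ∀ n, (Fin n → X) → ℝ := fun n x => ((1 / (n : ℝ)) * ∑ i, K.estCost (x i) - μ₁) ^ 2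
    with hφ₁
  set φ₂ : ∀ n, (Fin n → X) → ℝ := fun n x => ((1 / (n : ℝ)) * ∑ i, K.v (x i) - μ₂) ^ 2
    with hφ₂
  set M : ℕ → ℕ := fun n => ⌈Real.exp ((n : ℝ) * R)⌉₊ with hMdef
  have hM : ∀ n, M n ≠ 0 := fun n => ceil_exp_ne_zero _
  have hcode : ∀ n : ℕ, ∃ (enc : Fin (M n) → Fin n → X) (dec : (Fin n → Y) → Fin (M n)),
      (1 / (M n : ℝ)) * ∑ m, ((∑ y, if dec y ≠ m then ∏ i, K.marginal (enc m i) (y i) else 0) +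
        (φ₁ n (enc m) + φ₂ n (enc m))) ≤ _ := fun n =>
    exists_code_le (fun x : Fin n → X => ∏ i, P (x i)) (prod_mem_stdSimplex _ fun _ => hP)
      (fun (x : Fin n → X) (y : Fin n → Y) => ∏ i, K.marginal (x i) (y i))
      (fun x => prod_mem_stdSimplex _ fun i => K.marginal_mem (x i))
      (fun y => ∏ i, K.outputLaw P (y i))
      (fun y => by
        simp only [← Finset.prod_mul_distrib, outputLaw]
        exact (sum_pi_prod fun k x => P x * K.marginal x (y k)).symm)
      (Real.exp_pos (n * τ)) (Nat.pos_of_ne_zero (hM n)) (fun x => φ₁ n x + φ₂ n x)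
  choose enc dec hbound using hcode
  set c : ∀ n, Code X Y S (M n) n := fun n =>
    ⟨enc n, dec n, fun y i => h (enc n (dec n y) i) (y i)⟩ with hc
  set E : ℕ → ℝ := fun n => (C + ∑ x, P x * (K.estCost x - μ₁) ^ 2 +
    ∑ x, P x * (K.v x - μ₂) ^ 2) / n + ((M n : ℝ) - 1) / Real.exp (n * τ) with hE
  have hElim : Tendsto E atTop (𝓝 0) := by
    simpa using (tendsto_const_div_atTop_nhds_zero_nat (C + ∑ x, P x * (K.estCost x - μ₁) ^ 2 +
      ∑ x, P x * (K.v x - μ₂) ^ 2)).add hrate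
  have hsqrt : Tendsto (fun n => √(E n)) atTop (𝓝 0) := by
    simpa [Function.comp_def] using (Real.continuous_sqrt.tendsto 0).comp hElim
  have hle : ∀ n, n ≠ 0 → K.errorProb (c n) + (1 / (M n : ℝ)) * ∑ m, φ₁ n (enc n m) +
      (1 / (M n : ℝ)) * ∑ m, φ₂ n (enc n m) ≤ E n := by
    intro n hn
    have h1 := hbound n
    have h2 := hC n hn
    have h3 := sum_pi_prod_mul_sq_average_sub P hP.2 K.estCost hn
    have h4 := sum_pi_prod_mul_sq_average_sub P hP.2 K.v hn
    simp only [mul_add, Finset.sum_add_distrib] at h1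
    rw [errorProb_eq]
    simp only [hE, add_div]
    simp only [hφ₁, hφ₂, hc] at h1 ⊢
    linarith
  have hφ₁0 : ∀ n, 0 ≤ (1 / (M n : ℝ)) * ∑ m, φ₁ n (enc n m) := fun n =>
    mul_nonneg (by positivity) (Finset.sum_nonneg fun m _ => sq_nonneg _)
  have hφ₂0 : ∀ n, 0 ≤ (1 / (M n : ℝ)) * ∑ m, φ₂ n (enc n m) := fun n =>
    mul_nonneg (by positivity) (Finset.sum_nonneg fun m _ => sq_nonneg _)
  have herrE : ∀ n, n ≠ 0 → K.errorProb (c n) ≤ E n := fun n hn => by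
    linarith [hle n hn, hφ₁0 n, hφ₂0 n]
  have hemp : ∀ (g : X → ℝ) (μ : ℝ) (n : ℕ), (1 / (M n : ℝ)) * ∑ m,
      ((1 / (n : ℝ)) * ∑ i, g (enc n m i) - μ) ^ 2 ≤ E n →
      ∑ x, empiricalLaw (c n) x * g x ≤ μ + √(E n) := by
    intro g μ n hg
    have h1 := average_le_sqrt_of_average_sq_le _ hg
    have hMr : (M n : ℝ) ≠ 0 := by exact_mod_cast hM n
    rw [Finset.sum_sub_distrib, mul_sub, ← Finset.mul_sum, ← mul_assoc, one_div_mul_one_div,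
      Finset.sum_const, Finset.card_univ, Fintype.card_fin, nsmul_eq_mul, ← mul_assoc,
      one_div_mul_cancel hMr, one_mul, mul_comm (M n : ℝ)] at h1
    rw [sum_empiricalLaw_mul]
    linarith
  refine ⟨c, ?_, ?_, ?_⟩
  · exact tendsto_of_tendsto_of_tendsto_of_le_of_le' tendsto_const_nhds hElim
      (Eventually.of_forall fun n => K.errorProb_nonneg _)
      ((eventually_ne_atTop 0).mono fun n hn => herrE n hn)
  · refine limsup_le_of_le_add (e := fun n => √(E n) + B * E n)
      (fun n => K.avgDistortion_nonneg _) (by simpa using hsqrt.add (hElim.const_mul B)) ?_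
    filter_upwards [eventually_ne_atTop 0] with n hn
    have h1 := K.avgDistortion_le_of_est_eq hB hh hn (c n) fun _ _ => rfl
    have h2 := hemp K.estCost μ₁ n (by
      linarith [hle n hn, hφ₂0 n, K.errorProb_nonneg (c n)])
    have h3 := mul_le_mul_of_nonneg_left (herrE n hn) hB0
    have h4 : μ₁ ≤ D := hPD.2
    linarith
  · refine limsup_le_of_le_add (fun n => K.avgCost_nonneg _) hsqrt ?_
    filter_upwards [eventually_ne_atTop 0] with n hn
    rw [avgCost_eq_sum_empiricalLaw]
    have h2 := hemp K.v μ₂ n (by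
      linarith [hle n hn, hφ₁0 n, K.errorProb_nonneg (c n)])
    have h4 : μ₂ ≤ V := hPV.2
    linarith

theorem achievable_of_lt_inputInfo (K : Model X Y S) {P : X → ℝ} {R D V : ℝ}
    (hPD : P ∈ K.estSet D) (hPV : P ∈ K.costSet V) (hR : R < K.inputInfo P) :
    K.Achievable R D V := by
  obtain ⟨τ, hRτ, hτ⟩ := exists_between hR
  refine K.achievable_of_tendsto hPD hPV hτ ?_
  have hlim : Tendsto (fun n : ℕ => Real.exp (-((n : ℝ) * (τ - R)))) atTop (𝓝 0) :=
    Real.tendsto_exp_neg_atTop_nhds_zero.comp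
      (tendsto_natCast_atTop_atTop.atTop_mul_const (sub_pos.2 hRτ))
  refine squeeze_zero (fun n => ?_) (fun n => ?_) hlim
  · have : 1 ≤ ⌈Real.exp ((n : ℝ) * R)⌉₊ := Nat.pos_of_ne_zero (ceil_exp_ne_zero _)
    have : (1 : ℝ) ≤ ⌈Real.exp ((n : ℝ) * R)⌉₊ := by exact_mod_cast this
    exact div_nonneg (by linarith) (Real.exp_pos _).le
  · rw [div_le_iff₀ (Real.exp_pos _), ← Real.exp_add]
    have h1 := (Nat.ceil_lt_add_one (Real.exp_pos ((n : ℝ) * R)).le).le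
    have h2 : -((n : ℝ) * (τ - R)) + n * τ = n * R := by ring
    rw [h2]
    linarith

/-- With one message `M - 1 = 0`, so `τ` may be any number below the information, even when that
information is 0. -/
theorem achievable_zero (K : Model X Y S) {P : X → ℝ} {D V : ℝ}
    (hPD : P ∈ K.estSet D) (hPV : P ∈ K.costSet V) : K.Achievable 0 D V :=
  K.achievable_of_tendsto hPD hPV (sub_one_lt _) (by simp)

/-! ### Compactness of the feasible set and conclusion. -/

theorem isCompact_estSet_inter_costSet (K : Model X Y S) (D V : ℝ) :
    IsCompact (K.estSet D ∩ K.costSet V) := by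
  have hlin : ∀ (g : X → ℝ) (a : ℝ), IsClosed {P : X → ℝ | ∑ x, P x * g x ≤ a} := fun g a =>
    isClosed_le (by fun_prop) continuous_const
  have hsimp := isCompact_stdSimplex ℝ X
  exact (hsimp.inter_right (hlin _ _)).inter (hsimp.inter_right (hlin _ _))

end Model

end JointCommEst

end

theorem theorem2 {X Y S : Type*} [Fintype X] [Fintype Y] [Fintype S]
    (K : JointCommEst.Model X Y S) (D V : ℝ) :
    ((K.achievableRates D V).Nonempty ↔ (K.estSet D ∩ K.costSet V).Nonempty) ∧
    ((K.estSet D ∩ K.costSet V).Nonempty →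
      BddAbove (K.achievableRates D V) ∧
      IsGreatest (K.inputInfo '' (K.estSet D ∩ K.costSet V)) (K.capacity D V)) := by
  refine ⟨⟨?_, ?_⟩, fun hne => ?_⟩
  · rintro ⟨R, -, hR⟩
    obtain ⟨P, hP, -⟩ := K.exists_le_inputInfo_of_achievable hR
    exact ⟨P, hP⟩
  · rintro ⟨P, hPD, hPV⟩
    exact ⟨0, le_rfl, K.achievable_zero hPD hPV⟩
  · obtain ⟨P, hP, hmax⟩ := (K.isCompact_estSet_inter_costSet D V).exists_isMaxOn hne
      (K.continuousOn_inputInfo.mono fun P hP => hP.1.1)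
    have hupper : ∀ R ∈ K.achievableRates D V, R ≤ K.inputInfo P := by
      rintro R ⟨-, hR⟩
      obtain ⟨Q, hQ, hRQ⟩ := K.exists_le_inputInfo_of_achievable hR
      exact hRQ.trans (hmax hQ)
    have hzero : (0 : ℝ) ∈ K.achievableRates D V := ⟨le_rfl, K.achievable_zero hP.1 hP.2⟩
    have hbdd : BddAbove (K.achievableRates D V) := ⟨_, hupper⟩
    have hcap : K.capacity D V = K.inputInfo P := by
      refine le_antisymm (csSup_le ⟨0, hzero⟩ hupper) (le_of_forall_lt fun R hR => ?_)
      obtain ⟨R', hRR', hR'⟩ := exists_between hR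
      -- Only nonnegative rates are admitted; a negative `R'` is dominated by the achievable rate 0.
      rcases le_or_gt 0 R' with h0 | h0
      · exact hRR'.trans_le
          (le_csSup hbdd ⟨h0, K.achievable_of_lt_inputInfo hP.1 hP.2 hR'⟩)
      · exact (hRR'.trans h0).trans_le (le_csSup hbdd hzero)
    refine ⟨hbdd, ?_⟩
    rw [hcap]
    refine ⟨⟨P, hP, rfl⟩, ?_⟩
    rintro _ ⟨Q, hQ, rfl⟩
    exact hmax hQ
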